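/- Rings are commutative and unital, and $\mathbb{N}$ is the multiplicative monoid of positive integers. For a ring $A$ let $\mathbb{W}(A)$ be the ring of big Witt vectors: the set $A^{\mathbb{N}}$ with the natural ring structure for which all ghost maps $w_n(a)=\sum_{d\mid n} d\,a_d^{n/d}$ are ring homomorphisms. Let $\epsilon_A=w_1\colon\mathbb{W}(A)\to A$, and let $\Delta_A\colon\mathbb{W}(A)\to\mathbb{W}(\mathbb{W}(A))$ be the natural ring homomorphism with $w_n\circ\Delta_A=F_n$, where $F_n\colon\mathbb{W}(A)\to\mathbb{W}(A)$ is the natural ring homomorphism with $w_m\circ F_n=w_{nm}$ for all $m$. A $\lambda$-ring $(A,\lambda_A)$ is a ring $A$ with a ring homomorphism $\lambda_A\colon A\to\mathbb{W}(A)$ such that $\epsilon_A\lambda_A=\mathrm{id}$ and $\mathbb{W}(\lambda_A)\lambda_A=\Delta_A\lambda_A$. Its Adams operations are $\psi_{A,n}=w_n\circ\lambda_A\colon A\to A$. For an $A$-module $M$ let $\mathbb{W}(M)=M^{\mathbb{N}}$ with componentwise addition and the $\mathbb{W}(A)$-module structure $(ax)_n=w_n(a)x_n$; put $\epsilon_M(x)=x_1$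 and $(\Delta_M(x)_e)_m=x_{em}$. An $(A,\lambda_A)$-module is an $A$-module $M$ with a $\lambda_A$-linear map $\lambda_M\colon M\to\mathbb{W}(M)$ such that $\epsilon_M\lambda_M=\mathrm{id}$ and $\mathbb{W}(\lambda_M)\lambda_M=\Delta_M\lambda_M$. A morphism $(M,\lambda_M)\to(N,\lambda_N)$ is an $A$-linear map $h$ with $\lambda_N h=\mathbb{W}(h)\lambda_M$. Let $\mathscr{M}(A,\lambda_A)$ be the category of $(A,\lambda_A)$-modules, and $u'\colon\mathscr{M}(A,\lambda_A)\to\mathscr{M}(A)$ the forgetful functor to $A$-modules. **Proposition.** Let $(A,\lambda_A)$ be a $\lambda$-ring. 1. The category $\mathscr{M}(A,\lambda_A)$ is abelian. 2. The functor $u'$ creates all small limits and all small colimits. That is, for every small diagram $K$ in $\mathscr{M}(A,\lambda_A)$, every limit cone over $u'K$ is the image under $u'$ of exactly one cone over $K$, and every cone over $K$ whose image is a limit cone is itself a limit cone; and dually for colimits. 3. Let $A^{\psi}[\mathbb{N}]$ be the twisted monoid algebra, i.e. the free $A$-module on $\mathbb{N}$ with the multiplication determined by $n\cdot a=\psi_{A,n}(a)\cdot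 n$. There is an equivalence of categories from $\mathscr{M}(A,\lambda_A)$ to the category of left $A^{\psi}[\mathbb{N}]$-modules which is compatible, up to natural isomorphism, with the forgetful functors to $\mathscr{M}(A)$, and under which multiplication by $n\in\mathbb{N}$ corresponds to the $n$th component $\lambda_{M,n}\colon M\to M$ of $\lambda_M$. -/

import Mathlib

open CategoryTheory CategoryTheory.Limits

universe u v

noncomputable section

/-- The ring `𝕎(A)` of big Witt vectors: as a set, the sequences in `A` indexed by the positive
integers. -/
@[ext]
structure BigWitt (A : Type*) where
  /-- The `n`th Witt component. -/
  coeff : ℕ+ → A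

namespace BigWitt

/-- The positive divisors of `n`. -/
def divs (n : ℕ+) : Finset ℕ+ := (Finset.Icc 1 n).filter fun d => (d : ℕ) ∣ (n : ℕ)

theorem mem_divs {n d : ℕ+} : d ∈ divs n ↔ d ∣ n := by
  simp only [divs, Finset.mem_filter, Finset.mem_Icc, ← PNat.dvd_iff, and_iff_right_iff_imp]
  exact fun h => ⟨one_le, PNat.le_of_dvd h⟩

/-- The ghost component `w_n(a) = ∑_{d ∣ n} d a_d^{n/d}`. -/
def ghostFun {A : Type*} [CommRing A] (a : BigWitt A) (n : ℕ+) : A :=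
  ∑ d ∈ divs n, ((d : ℕ) : A) * a.coeff d ^ ((n : ℕ) / (d : ℕ))

/-- `𝕎(f)` as a map of sets: apply `f` to every Witt component. -/
def mapFun {A B : Type*} (f : A → B) (a : BigWitt A) : BigWitt B := ⟨fun n => f (a.coeff n)⟩

theorem ghostFun_mapFun {A B : Type*} [CommRing A] [CommRing B] (f : A →+* B) (a : BigWitt A)
    (n : ℕ+) : ghostFun (mapFun f a) n = f (ghostFun a n) := by
  simp [ghostFun, mapFun, map_sum, map_mul, map_pow]

theorem mapFun_surjective {A B : Type*} {f : A → B} (hf : Function.Surjective f) :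
    Function.Surjective (mapFun f) := fun b => by
  choose g hg using hf
  exact ⟨⟨fun n => g (b.coeff n)⟩, BigWitt.ext (funext fun n => hg _)⟩

theorem divs_eq (n : ℕ+) : divs n = insert n ((divs n).erase n) :=
  (Finset.insert_erase (mem_divs.2 dvd_rfl)).symm

theorem lt_of_mem_erase {n d : ℕ+} (h : d ∈ (divs n).erase n) : d < n :=
  lt_of_le_of_ne (PNat.le_of_dvd (mem_divs.1 (Finset.mem_of_mem_erase h)))
    (Finset.ne_of_mem_erase h)

theorem ghostFun_eq {A : Type*} [CommRing A] (a : BigWitt A) (n : ℕ+) :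
    ghostFun a n = ((n : ℕ) : A) * a.coeff n +
      ∑ d ∈ (divs n).erase n, ((d : ℕ) : A) * a.coeff d ^ ((n : ℕ) / (d : ℕ)) := by
  rw [ghostFun, divs_eq, Finset.sum_insert (Finset.notMem_erase _ _), ← divs_eq,
    Nat.div_self n.pos, pow_one]

theorem ghostFun_injective {A : Type*} [CommRing A] [IsAddTorsionFree A] {a b : BigWitt A}
    (h : ∀ n, ghostFun a n = ghostFun b n) : a = b := by
  ext n
  induction n using PNat.strongInductionOn with
  | _ n ih =>
    have h1 := h n
    rw [ghostFun_eq, ghostFun_eq, Finset.sum_congr rfl fun d hd => by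
      rw [ih d (lt_of_mem_erase hd)]] at h1
    have h2 := add_right_cancel h1
    rw [← nsmul_eq_mul, ← nsmul_eq_mul] at h2
    exact nsmul_right_injective n.ne_zero h2

/-! ### Dwork's lemma -/

theorem dvd_mul_pow_sub {R : Type*} [CommRing R] {p : ℕ} (hp : p.Prime) {a b : R}
    (h : (p : R) ∣ a - b) {k d e : ℕ} (hk : p ^ k ∣ d * e) :
    ((p ^ (k + 1) : ℕ) : R) ∣ (d : R) * (a ^ e - b ^ e) := by
  obtain ⟨x, y, hx, hy, hxy⟩ := exists_dvd_and_dvd_of_dvd_mul hk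
  obtain ⟨j, -, rfl⟩ := (Nat.dvd_prime_pow hp).1 (Dvd.intro_left x hxy.symm)
  obtain ⟨t, rfl⟩ := hy
  have h1 : ((p : R) ^ (j + 1)) ∣ a ^ (p ^ j * t) - b ^ (p ^ j * t) := by
    rw [pow_mul, pow_mul]
    exact (dvd_sub_pow_of_dvd_sub h j).trans (sub_dvd_pow_sub_pow _ _ t)
  have h2 : ((p ^ (k + 1) : ℕ) : R) = (x : R) * (p : R) ^ (j + 1) := by
    rw [pow_succ, hxy]; push_cast; ring
  rw [h2]
  exact mul_dvd_mul (Nat.cast_dvd_cast hx) h1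

theorem dvd_of_dvd_mul_of_not_dvd {p k m d : ℕ} (hp : p.Prime) (hk : p ^ k ∣ m)
    (hd : d ∣ p * m) (hdm : ¬ d ∣ m) : p ^ (k + 1) ∣ d := by
  obtain ⟨e, he⟩ := hd
  have hpe : ¬ p ∣ e := by
    rintro ⟨t, rfl⟩
    apply hdm
    refine ⟨t, Nat.eq_of_mul_eq_mul_left hp.pos ?_⟩
    rw [he]; ring
  have : p ^ (k + 1) ∣ d * e := by
    rw [← he, pow_succ, mul_comm]; exact mul_dvd_mul_left p hk
  exact (Nat.Coprime.pow_left _ ((Nat.Prime.coprime_iff_not_dvd hp).2 hpe)).dvd_of_dvd_mul_right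
    this

/-- The congruences in Dwork's lemma. -/
def DworkCong {R : Type*} [CommRing R] (φ : ℕ → R →+* R) (x : ℕ+ → R) : Prop :=
  ∀ (p : ℕ+) (k : ℕ) (m : ℕ+), (p : ℕ).Prime → (p : ℕ) ^ k ∣ (m : ℕ) →
    ((((p : ℕ) ^ (k + 1) : ℕ)) : R) ∣ x (p * m) - φ p (x m)

theorem dworkCong_ghostFun {R : Type*} [CommRing R] {φ : ℕ → R →+* R}
    (hφ : ∀ p : ℕ, p.Prime → ∀ r, (p : R) ∣ φ p r - r ^ p) (a : BigWitt R) :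
    DworkCong φ (ghostFun a) := by
  intro p k m hp hk
  have hsub : divs m ⊆ divs (p * m) := fun d hd =>
    mem_divs.2 ((mem_divs.1 hd).trans (Dvd.intro_left p rfl))
  rw [ghostFun, ghostFun, map_sum, ← Finset.sum_sdiff hsub, add_sub_assoc,
    ← Finset.sum_sub_distrib]
  refine dvd_add (Finset.dvd_sum fun d hd => ?_) (Finset.dvd_sum fun d hd => ?_)
  · rw [Finset.mem_sdiff, mem_divs, mem_divs, PNat.dvd_iff, PNat.dvd_iff, PNat.mul_coe] at hd
    exact (Nat.cast_dvd_cast (dvd_of_dvd_mul_of_not_dvd hp hk hd.1 hd.2)).mul_right _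
  · obtain ⟨e, he⟩ := PNat.dvd_iff.1 (mem_divs.1 hd)
    rw [map_mul, map_natCast, map_pow, ← mul_sub, PNat.mul_coe, he, mul_left_comm,
      Nat.mul_div_cancel_left _ d.pos, Nat.mul_div_cancel_left _ d.pos, pow_mul,
      ← dvd_neg, ← mul_neg, neg_sub]
    exact dvd_mul_pow_sub hp (hφ p hp _) (he ▸ hk)

theorem natCast_dvd_of_forall_prime_pow {R : Type*} [CommRing R] (n : ℕ) (hn : n ≠ 0) (y : R) :
    (∀ p k : ℕ, p.Prime → p ^ k ∣ n → ((p ^ k : ℕ) : R) ∣ y) → (n : R) ∣ y := by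
  induction n using Nat.recOnPosPrimePosCoprime with
  | prime_pow p k hp _ => exact fun h => h p k hp dvd_rfl
  | zero => exact absurd rfl hn
  | one => simp
  | coprime a b ha hb hab iha ihb =>
    intro h
    have h1 := iha (by omega) fun p k hp hk => h p k hp (hk.mul_right _)
    have h2 := ihb (by omega) fun p k hp hk => h p k hp (hk.mul_left _)
    rw [Nat.cast_mul]
    exact (Nat.Coprime.cast hab).mul_dvd h1 h2

/-- The solution `a` of `w(a) = x`, constructed recursively. -/
def dworkVec {R : Type*} [CommRing R] (x : ℕ+ → R) (n : ℕ+) : R :=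
  Classical.epsilon fun y : R => ((n : ℕ) : R) * y = x n -
    ∑ d ∈ ((divs n).erase n).attach,
      ((d.1 : ℕ) : R) * dworkVec x d.1 ^ ((n : ℕ) / (d.1 : ℕ))
termination_by n
decreasing_by exact lt_of_mem_erase d.2

theorem dwork {R : Type*} [CommRing R] {φ : ℕ → R →+* R}
    (hφ : ∀ p : ℕ, p.Prime → ∀ r, (p : R) ∣ φ p r - r ^ p) {x : ℕ+ → R} (hx : DworkCong φ x) :
    ∃ a : BigWitt R, ∀ n, ghostFun a n = x n := by
  refine ⟨⟨dworkVec x⟩, fun n => ?_⟩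
  induction n using PNat.strongInductionOn with
  | _ n ih =>
    have key : ∃ y : R, ((n : ℕ) : R) * y = x n -
        ∑ d ∈ ((divs n).erase n).attach,
          ((d.1 : ℕ) : R) * dworkVec x d.1 ^ ((n : ℕ) / (d.1 : ℕ)) := by
      obtain ⟨y, hy⟩ : ((n : ℕ) : R) ∣ x n -
        ∑ d ∈ ((divs n).erase n).attach,
          ((d.1 : ℕ) : R) * dworkVec x d.1 ^ ((n : ℕ) / (d.1 : ℕ)) := by
        refine natCast_dvd_of_forall_prime_pow _ n.ne_zero _ fun p k hp hk => ?_
        obtain _ | k := k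
        · simp
        obtain ⟨m, hm⟩ : p ∣ (n : ℕ) := (dvd_pow_self p k.succ_ne_zero).trans hk
        have hm0 : 0 < m := Nat.pos_of_ne_zero (by rintro rfl; simp at hm)
        lift m to ℕ+ using hm0
        have hp0 := hp.pos
        lift p to ℕ+ using hp0
        obtain rfl : n = p * m := PNat.eq (by simpa using hm)
        have hkm : (p : ℕ) ^ k ∣ (m : ℕ) := by
          rw [PNat.mul_coe, pow_succ, mul_comm] at hk
          exact Nat.dvd_of_mul_dvd_mul_left p.pos hk
        have hlt : m < p * m := by
          rw [← PNat.coe_lt_coe, PNat.mul_coe]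
          exact lt_mul_of_one_lt_left m.pos hp.one_lt
        have h1 := dworkCong_ghostFun hφ ⟨dworkVec x⟩ p k m hp hkm
        rw [ih m hlt, ghostFun_eq] at h1
        have h2 := dvd_sub (dvd_sub (hx p k m hp hkm) h1) (dvd_neg.2
          ((Nat.cast_dvd_cast (α := R) hk).mul_right (dworkVec x (p * m))))
        rw [Finset.sum_attach ((divs (p * m)).erase (p * m)) fun d =>
          ((d : ℕ) : R) * dworkVec x d ^ (((p * m : ℕ+) : ℕ) / (d : ℕ))]
        convert h2 using 1
        ring
      exact ⟨y, hy.symm⟩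
    have h := Classical.epsilon_spec key
    rw [← dworkVec, Finset.sum_attach ((divs n).erase n) fun d =>
      ((d : ℕ) : R) * dworkVec x d ^ ((n : ℕ) / (d : ℕ))] at h
    rw [ghostFun_eq, h]
    ring

/-! ### The ring structure -/

/-- The Frobenius lift `x_i ↦ x_i^p` on an integral polynomial ring. -/
def lift (σ : Type*) (p : ℕ) : MvPolynomial σ ℤ →+* MvPolynomial σ ℤ :=
  (MvPolynomial.expand p : MvPolynomial σ ℤ →ₐ[ℤ] MvPolynomial σ ℤ)

theorem frobLift_of_X {R : Type*} [CommRing R] {σ : Type*} {p : ℕ} (hp : p.Prime)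
    (φ : MvPolynomial σ ℤ →+* R) (ψ : MvPolynomial σ ℤ →+* R)
    (h : ∀ i, (p : R) ∣ ψ (.X i) - φ (.X i) ^ p) (r : MvPolynomial σ ℤ) :
    (p : R) ∣ ψ r - φ r ^ p := by
  have := Fact.mk hp
  let I : Ideal R := Ideal.span {(p : R)}
  by_cases hI : Subsingleton (R ⧸ I)
  · rw [← Ideal.mem_span_singleton, ← Ideal.Quotient.eq]
    exact Subsingleton.elim _ _
  have : Nontrivial (R ⧸ I) := not_subsingleton_iff_nontrivial.1 hI
  have hp0 : ((p : ℕ) : R ⧸ I) = 0 := by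
    rw [← map_natCast (Ideal.Quotient.mk I), Ideal.Quotient.eq_zero_iff_mem]
    exact Ideal.mem_span_singleton_self _
  have : CharP (R ⧸ I) p := by
    obtain ⟨q, hq⟩ := CharP.exists (R ⧸ I)
    have h1 : q ∣ p := (CharP.cast_eq_zero_iff (R ⧸ I) q p).1 hp0
    rcases (Nat.dvd_prime hp).1 h1 with rfl | rfl
    · have h2 := (CharP.cast_eq_zero_iff (R ⧸ I) 1 1).2 dvd_rfl
      rw [Nat.cast_one] at h2
      exact absurd h2 one_ne_zero
    · exact hq
  have key : (Ideal.Quotient.mk I).comp ψ =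
      (frobenius (R ⧸ I) p).comp ((Ideal.Quotient.mk I).comp φ) := by
    refine MvPolynomial.ringHom_ext (fun z => by simp) fun i => ?_
    rw [RingHom.comp_apply, RingHom.comp_apply, RingHom.comp_apply, frobenius_def, ← map_pow]
    exact Ideal.Quotient.eq.2 (Ideal.mem_span_singleton.2 (h i))
  have := congrArg (fun f => f r) key
  rw [RingHom.comp_apply, RingHom.comp_apply, RingHom.comp_apply, frobenius_def,
    ← map_pow (Ideal.Quotient.mk I)] at this
  exact Ideal.mem_span_singleton.1 (Ideal.Quotient.eq.1 this)

theorem lift_spec (σ : Type*) (p : ℕ) (hp : p.Prime) (r : MvPolynomial σ ℤ) :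
    (p : MvPolynomial σ ℤ) ∣ lift σ p r - r ^ p :=
  frobLift_of_X hp (RingHom.id _) (lift σ p) (fun i => by simp [lift]) r

/-- The universal Witt vectors `(x_{i,n})_n`. -/
def univ (ι : Type*) (i : ι) : BigWitt (MvPolynomial (ι × ℕ+) ℤ) := ⟨fun n => .X (i, n)⟩

/-- The map from the universal ring that specializes the universal vectors to `v`. -/
def spec {ι A : Type*} [CommRing A] (v : ι → BigWitt A) : MvPolynomial (ι × ℕ+) ℤ →+* A :=
  MvPolynomial.eval₂Hom (Int.castRingHom A) fun j => (v j.1).coeff j.2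

theorem mapFun_spec_univ {ι A : Type*} [CommRing A] (v : ι → BigWitt A) (i : ι) :
    mapFun (spec v) (univ ι i) = v i := by
  ext n; simp [mapFun, spec, univ]

theorem mapFun_comp {A B C : Type*} (g : B → C) (f : A → B) (a : BigWitt A) :
    mapFun g (mapFun f a) = mapFun (fun x => g (f x)) a := rfl

theorem comp_spec {ι A B : Type*} [CommRing A] [CommRing B] (f : A →+* B) (v : ι → BigWitt A) :
    f.comp (spec v) = spec fun i => mapFun f (v i) := by
  refine MvPolynomial.ringHom_ext (fun z => by simp [spec]) fun i => by simp [spec, mapFun]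

/-- The natural operation on Witt vectors given by the universal vector `s`. -/
def op {ι A : Type*} [CommRing A] (s : BigWitt (MvPolynomial (ι × ℕ+) ℤ)) (v : ι → BigWitt A) :
    BigWitt A := mapFun (spec v) s

theorem mapFun_op {ι A B : Type*} [CommRing A] [CommRing B] (f : A →+* B)
    (s : BigWitt (MvPolynomial (ι × ℕ+) ℤ)) (v : ι → BigWitt A) :
    mapFun f (op s v) = op s fun i => mapFun f (v i) := by
  rw [op, op, ← comp_spec]; rfl

theorem exists_sum : ∃ s : BigWitt (MvPolynomial (Bool × ℕ+) ℤ), ∀ n,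
    ghostFun s n = ghostFun (univ Bool false) n + ghostFun (univ Bool true) n :=
  dwork (lift_spec _) fun p k m hp hk => by
    rw [map_add, add_sub_add_comm]
    exact dvd_add (dworkCong_ghostFun (lift_spec _) _ p k m hp hk)
      (dworkCong_ghostFun (lift_spec _) _ p k m hp hk)

theorem exists_prod : ∃ s : BigWitt (MvPolynomial (Bool × ℕ+) ℤ), ∀ n,
    ghostFun s n = ghostFun (univ Bool false) n * ghostFun (univ Bool true) n :=
  dwork (lift_spec _) fun p k m hp hk => by
    rw [map_mul]
    have h1 := dworkCong_ghostFun (lift_spec _) (univ Bool false) p k m hp hk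
    have h2 := dworkCong_ghostFun (lift_spec _) (univ Bool true) p k m hp hk
    convert dvd_add (h1.mul_right (ghostFun (univ Bool true) (p * m)))
      (h2.mul_left (lift _ p (ghostFun (univ Bool false) m))) using 1
    ring

theorem exists_neg : ∃ s : BigWitt (MvPolynomial (Unit × ℕ+) ℤ), ∀ n,
    ghostFun s n = - ghostFun (univ Unit ()) n :=
  dwork (lift_spec _) fun p k m hp hk => by
    rw [map_neg, ← neg_sub', dvd_neg]
    exact dworkCong_ghostFun (lift_spec _) _ p k m hp hk

theorem exists_frob (n : ℕ+) : ∃ s : BigWitt (MvPolynomial (Unit × ℕ+) ℤ), ∀ m,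
    ghostFun s m = ghostFun (univ Unit ()) (n * m) :=
  dwork (lift_spec _) fun p k m hp hk => by
    rw [mul_left_comm]
    exact dworkCong_ghostFun (lift_spec _) _ p k _ hp
      (by rw [PNat.mul_coe]; exact hk.mul_left _)

/-- The pair of vectors `a`, `b`. -/
def pair {A : Type*} (a b : BigWitt A) (i : Bool) : BigWitt A := bif i then b else a

theorem mapFun_pair {A B : Type*} (f : A → B) (a b : BigWitt A) :
    (fun i => mapFun f (pair a b i)) = pair (mapFun f a) (mapFun f b) :=
  funext fun i => by cases i <;> rfl

section Ops

variable {A B : Type*} [CommRing A] [CommRing B]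

instance : Zero (BigWitt A) := ⟨⟨fun _ => 0⟩⟩
instance : One (BigWitt A) := ⟨⟨fun n => if n = 1 then 1 else 0⟩⟩
instance : Add (BigWitt A) := ⟨fun a b => op exists_sum.choose (pair a b)⟩
instance : Mul (BigWitt A) := ⟨fun a b => op exists_prod.choose (pair a b)⟩
instance : Neg (BigWitt A) := ⟨fun a => op exists_neg.choose fun _ => a⟩

theorem ghostFun_op {ι : Type*} (s : BigWitt (MvPolynomial (ι × ℕ+) ℤ)) (v : ι → BigWitt A)
    (n : ℕ+) : ghostFun (op s v) n = spec v (ghostFun s n) := ghostFun_mapFun _ _ _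

theorem spec_ghostFun_univ {ι : Type*} (v : ι → BigWitt A) (i : ι) (n : ℕ+) :
    spec v (ghostFun (univ ι i) n) = ghostFun (v i) n := by
  rw [← ghostFun_mapFun, mapFun_spec_univ]

theorem ghostFun_add (a b : BigWitt A) (n : ℕ+) :
    ghostFun (a + b) n = ghostFun a n + ghostFun b n := by
  refine (ghostFun_op _ _ n).trans ?_
  rw [exists_sum.choose_spec n, map_add, spec_ghostFun_univ, spec_ghostFun_univ]; rfl

theorem ghostFun_mul (a b : BigWitt A) (n : ℕ+) :
    ghostFun (a * b) n = ghostFun a n * ghostFun b n := by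
  refine (ghostFun_op _ _ n).trans ?_
  rw [exists_prod.choose_spec n, map_mul, spec_ghostFun_univ, spec_ghostFun_univ]; rfl

theorem ghostFun_neg (a : BigWitt A) (n : ℕ+) : ghostFun (-a) n = - ghostFun a n := by
  refine (ghostFun_op _ _ n).trans ?_
  rw [exists_neg.choose_spec n, map_neg, spec_ghostFun_univ]

theorem div_pos_of_dvd {n d : ℕ+} (h : d ∣ n) : (n : ℕ) / (d : ℕ) ≠ 0 :=
  (Nat.div_pos (PNat.le_of_dvd h) d.pos).ne'

theorem ghostFun_zero (n : ℕ+) : ghostFun (0 : BigWitt A) n = 0 :=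
  Finset.sum_eq_zero fun d hd => by
    change _ * (0 : A) ^ _ = 0
    rw [zero_pow (div_pos_of_dvd (mem_divs.1 hd)), mul_zero]

theorem ghostFun_one (n : ℕ+) : ghostFun (1 : BigWitt A) n = 1 := by
  rw [ghostFun, Finset.sum_eq_single 1]
  · change _ * (if (1 : ℕ+) = 1 then (1 : A) else 0) ^ _ = 1
    simp
  · intro d hd h1
    change _ * (if d = 1 then (1 : A) else 0) ^ _ = 0
    rw [if_neg h1, zero_pow (div_pos_of_dvd (mem_divs.1 hd)), mul_zero]
  · exact fun h => absurd (mem_divs.2 (one_dvd n)) h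

theorem mapFun_add (f : A →+* B) (a b : BigWitt A) :
    mapFun f (a + b) = mapFun f a + mapFun f b := by
  refine (mapFun_op f _ _).trans ?_
  rw [mapFun_pair]; rfl

theorem mapFun_mul (f : A →+* B) (a b : BigWitt A) :
    mapFun f (a * b) = mapFun f a * mapFun f b := by
  refine (mapFun_op f _ _).trans ?_
  rw [mapFun_pair]; rfl

theorem mapFun_neg (f : A →+* B) (a : BigWitt A) : mapFun f (-a) = - mapFun f a :=
  mapFun_op f _ _

theorem mapFun_zero (f : A →+* B) : mapFun f 0 = 0 := BigWitt.ext (funext fun _ => map_zero f)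

theorem mapFun_one (f : A →+* B) : mapFun f 1 = 1 := BigWitt.ext (funext fun n => by
  change f (if n = 1 then 1 else 0) = if n = 1 then 1 else 0
  split_ifs <;> simp)

variable (A) in
/-- The canonical surjection from a torsion free ring. -/
def cover : MvPolynomial A ℤ →+* A := MvPolynomial.eval₂Hom (Int.castRingHom A) id

variable (A) in
theorem cover_surjective : Function.Surjective (mapFun (cover A)) :=
  mapFun_surjective fun a => ⟨.X a, by simp [cover]⟩

theorem cover_ext {x y : BigWitt (MvPolynomial A ℤ)} (h : ∀ n, ghostFun x n = ghostFun y n) :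
    mapFun (cover A) x = mapFun (cover A) y := congrArg _ (ghostFun_injective h)

protected theorem add_assoc' (a b c : BigWitt A) : a + b + c = a + (b + c) := by
  obtain ⟨a, rfl⟩ := cover_surjective A a
  obtain ⟨b, rfl⟩ := cover_surjective A b
  obtain ⟨c, rfl⟩ := cover_surjective A c
  rw [← mapFun_add, ← mapFun_add, ← mapFun_add, ← mapFun_add]
  exact cover_ext fun n => by simp only [ghostFun_add, add_assoc]

protected theorem zero_add' (a : BigWitt A) : 0 + a = a := by
  obtain ⟨a, rfl⟩ := cover_surjective A a
  rw [← mapFun_zero (cover A), ← mapFun_add]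
  exact cover_ext fun n => by rw [ghostFun_add, ghostFun_zero, zero_add]

protected theorem neg_add_cancel' (a : BigWitt A) : -a + a = 0 := by
  obtain ⟨a, rfl⟩ := cover_surjective A a
  rw [← mapFun_zero (cover A), ← mapFun_neg, ← mapFun_add]
  exact cover_ext fun n => by rw [ghostFun_add, ghostFun_zero, ghostFun_neg, neg_add_cancel]

protected theorem mul_assoc' (a b c : BigWitt A) : a * b * c = a * (b * c) := by
  obtain ⟨a, rfl⟩ := cover_surjective A a
  obtain ⟨b, rfl⟩ := cover_surjective A b
  obtain ⟨c, rfl⟩ := cover_surjective A c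
  rw [← mapFun_mul, ← mapFun_mul, ← mapFun_mul, ← mapFun_mul]
  exact cover_ext fun n => by simp only [ghostFun_mul, mul_assoc]

protected theorem mul_comm' (a b : BigWitt A) : a * b = b * a := by
  obtain ⟨a, rfl⟩ := cover_surjective A a
  obtain ⟨b, rfl⟩ := cover_surjective A b
  rw [← mapFun_mul, ← mapFun_mul]
  exact cover_ext fun n => by rw [ghostFun_mul, ghostFun_mul, mul_comm]

protected theorem one_mul' (a : BigWitt A) : 1 * a = a := by
  obtain ⟨a, rfl⟩ := cover_surjective A a
  rw [← mapFun_one (cover A), ← mapFun_mul]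
  exact cover_ext fun n => by rw [ghostFun_mul, ghostFun_one, one_mul]

protected theorem left_distrib' (a b c : BigWitt A) : a * (b + c) = a * b + a * c := by
  obtain ⟨a, rfl⟩ := cover_surjective A a
  obtain ⟨b, rfl⟩ := cover_surjective A b
  obtain ⟨c, rfl⟩ := cover_surjective A c
  rw [← mapFun_mul, ← mapFun_mul, ← mapFun_add, ← mapFun_add, ← mapFun_mul]
  exact cover_ext fun n => by simp only [ghostFun_mul, ghostFun_add, mul_add]

instance : CommRing (BigWitt A) :=
  CommRing.ofMinimalAxioms BigWitt.add_assoc' BigWitt.zero_add' BigWitt.neg_add_cancel'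
    BigWitt.mul_assoc' BigWitt.mul_comm' BigWitt.one_mul' BigWitt.left_distrib'

/-- The `n`th ghost component `w_n : 𝕎(A) → A`, a ring homomorphism. -/
def ghost (n : ℕ+) : BigWitt A →+* A where
  toFun a := ghostFun a n
  map_one' := ghostFun_one n
  map_mul' a b := ghostFun_mul a b n
  map_zero' := ghostFun_zero n
  map_add' a b := ghostFun_add a b n

/-- Functoriality: `𝕎(f) : 𝕎(A) → 𝕎(B)`, applying `f` to every Witt component. -/
def map (f : A →+* B) : BigWitt A →+* BigWitt B where
  toFun := mapFun f
  map_one' := mapFun_one f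
  map_mul' := mapFun_mul f
  map_zero' := mapFun_zero f
  map_add' := mapFun_add f

theorem ghost_map (f : A →+* B) (a : BigWitt A) (n : ℕ+) : ghost n (map f a) = f (ghost n a) :=
  ghostFun_mapFun f a n

theorem ghost_injective [IsAddTorsionFree A] {a b : BigWitt A} (h : ∀ n, ghost n a = ghost n b) :
    a = b := ghostFun_injective h

instance [IsAddTorsionFree A] : IsAddTorsionFree (BigWitt A) where
  nsmul_right_injective n hn a b h := ghost_injective fun m => by
    have := congrArg (ghost m) h
    simp only [map_nsmul] at this
    exact nsmul_right_injective hn this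

variable (A) in
/-- The natural ring homomorphism `ε_A = w_1 : 𝕎(A) → A`. -/
def counit : BigWitt A →+* A := ghost 1

/-- The underlying map of the `n`th Frobenius. -/
def frobFun (n : ℕ+) (a : BigWitt A) : BigWitt A := op (exists_frob n).choose fun _ => a

theorem mapFun_frobFun (f : A →+* B) (n : ℕ+) (a : BigWitt A) :
    mapFun f (frobFun n a) = frobFun n (mapFun f a) := mapFun_op f _ _

theorem ghostFun_frobFun (n m : ℕ+) (a : BigWitt A) :
    ghostFun (frobFun n a) m = ghostFun a (n * m) := by
  refine (ghostFun_op _ _ m).trans ?_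
  rw [(exists_frob n).choose_spec m, spec_ghostFun_univ]

/-- The `n`th Frobenius `F_n : 𝕎(A) → 𝕎(A)`, the natural ring homomorphism with
`w_m(F_n(a)) = w_{nm}(a)`. -/
def frob (n : ℕ+) : BigWitt A →+* BigWitt A where
  toFun := frobFun n
  map_one' := by
    rw [← mapFun_one (cover A), ← mapFun_frobFun]
    exact cover_ext fun m => by simp only [ghostFun_frobFun, ghostFun_one]
  map_mul' a b := by
    obtain ⟨a, rfl⟩ := cover_surjective A a
    obtain ⟨b, rfl⟩ := cover_surjective A b
    rw [← mapFun_mul, ← mapFun_frobFun, ← mapFun_frobFun, ← mapFun_frobFun, ← mapFun_mul]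
    exact cover_ext fun m => by simp only [ghostFun_frobFun, ghostFun_mul]
  map_zero' := by
    rw [← mapFun_zero (cover A), ← mapFun_frobFun]
    exact cover_ext fun m => by simp only [ghostFun_frobFun, ghostFun_zero]
  map_add' a b := by
    obtain ⟨a, rfl⟩ := cover_surjective A a
    obtain ⟨b, rfl⟩ := cover_surjective A b
    rw [← mapFun_add, ← mapFun_frobFun, ← mapFun_frobFun, ← mapFun_frobFun, ← mapFun_add]
    exact cover_ext fun m => by simp only [ghostFun_frobFun, ghostFun_add]

theorem ghost_frob (n m : ℕ+) (a : BigWitt A) : ghost m (frob n a) = ghost (n * m) a :=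
  ghostFun_frobFun n m a

theorem map_frob (f : A →+* B) (n : ℕ+) (a : BigWitt A) :
    map f (frob n a) = frob n (map f a) := mapFun_frobFun f n a

end Ops

/-! ### The comultiplication -/

/-- The representing ring `ℤ[x_1, x_2, …]` of `𝕎`. -/
abbrev Rep : Type := MvPolynomial (Unit × ℕ+) ℤ

/-- The universal Witt vector `(x_1, x_2, …)`. -/
abbrev gen : BigWitt Rep := univ Unit ()

/-- The endomorphism of the representing ring that corepresents `F_n`. -/
def psi (n : ℕ+) : Rep →+* Rep := spec fun _ => frob n gen

theorem map_psi (n : ℕ+) : map (psi n) gen = frob n gen :=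
  mapFun_spec_univ (fun _ => frob n gen) ()

theorem psi_ghost (n m : ℕ+) : psi n (ghost m gen) = ghost (n * m) gen := by
  rw [← ghost_map, map_psi, ghost_frob]

theorem frob_coeff_congr (p : ℕ+) (hp : (p : ℕ).Prime) (n : ℕ+) :
    ((p : ℕ) : Rep) ∣ (frob p gen).coeff n - gen.coeff n ^ (p : ℕ) := by
  induction n using PNat.strongInductionOn with
  | _ n ih =>
    obtain ⟨k, t, ht, hn⟩ := Nat.exists_eq_pow_mul_and_not_dvd n.ne_zero (p : ℕ) hp.ne_one
    have hk : (p : ℕ) ^ k ∣ (n : ℕ) := ⟨t, hn⟩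
    have h1 := dworkCong_ghostFun (lift_spec _) gen p k n hp hk
    have h2 : lift _ (p : ℕ) (ghostFun gen n) = ((n : ℕ) : Rep) * gen.coeff n ^ (p : ℕ) +
        ∑ d ∈ (divs n).erase n,
          ((d : ℕ) : Rep) * (gen.coeff d ^ (p : ℕ)) ^ ((n : ℕ) / (d : ℕ)) := by
      rw [← ghostFun_mapFun, ghostFun_eq]
      simp [mapFun, lift, univ]
    rw [h2, ← ghostFun_frobFun p n gen, ghostFun_eq, add_sub_add_comm, ← mul_sub,
      ← Finset.sum_sub_distrib] at h1
    have h3 : ((((p : ℕ) ^ (k + 1) : ℕ)) : Rep) ∣ ∑ d ∈ (divs n).erase n,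
        (((d : ℕ) : Rep) * (frobFun p gen).coeff d ^ ((n : ℕ) / (d : ℕ)) -
          ((d : ℕ) : Rep) * (gen.coeff d ^ (p : ℕ)) ^ ((n : ℕ) / (d : ℕ))) := by
      refine Finset.dvd_sum fun d hd => ?_
      rw [← mul_sub]
      refine dvd_mul_pow_sub hp (ih d (lt_of_mem_erase hd)) ?_
      rwa [Nat.mul_div_cancel' (PNat.dvd_iff.1 (mem_divs.1 (Finset.mem_of_mem_erase hd)))]
    obtain ⟨c, hc⟩ := (dvd_add_left h3).1 h1
    have h4 : ((p : ℕ) : Rep) ∣ ((t : ℕ) : Rep) *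
        ((frobFun p gen).coeff n - gen.coeff n ^ (p : ℕ)) := by
      refine ⟨c, ?_⟩
      have h5 : (((p : ℕ) ^ k : ℕ) : Rep) ≠ 0 := by
        exact_mod_cast pow_ne_zero k hp.ne_zero
      refine mul_left_cancel₀ h5 ?_
      rw [hn] at hc
      push_cast at hc ⊢
      linear_combination hc
    exact (Nat.Coprime.cast ((Nat.Prime.coprime_iff_not_dvd hp).2 ht)).dvd_of_dvd_mul_left h4

theorem psi_comp (n m : ℕ+) : (psi n).comp (psi m) = psi (n * m) := by
  have h : map ((psi n).comp (psi m)) gen = map (psi (n * m)) gen := by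
    refine ghost_injective fun k => ?_
    rw [ghost_map, ghost_map, RingHom.comp_apply, psi_ghost, psi_ghost, psi_ghost, mul_assoc]
  refine MvPolynomial.ringHom_ext (fun z => by simp) fun i => ?_
  exact congrFun (congrArg coeff h) i.2

/-- The Frobenius lifts `psi p` on the representing ring. -/
def psiNat (p : ℕ) : Rep →+* Rep := if h : 0 < p then psi ⟨p, h⟩ else RingHom.id _

theorem psiNat_spec (p : ℕ) (hp : p.Prime) (r : Rep) : (p : Rep) ∣ psiNat p r - r ^ p := by
  refine frobLift_of_X hp (RingHom.id _) (psiNat p) (fun i => ?_) r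
  rw [psiNat, dif_pos hp.pos]
  have := frob_coeff_congr ⟨p, hp.pos⟩ hp i.2
  simpa [psi, spec, univ] using this

theorem exists_delta (e : ℕ+) : ∃ s : BigWitt Rep, ∀ n, ghost n s = psi n (gen.coeff e) :=
  dwork psiNat_spec fun p k m hp _ => by
    have h : psiNat (p : ℕ) = psi p := dif_pos p.pos
    rw [h, ← RingHom.comp_apply, psi_comp, sub_self]
    exact dvd_zero _

section Delta

variable {A B : Type*} [CommRing A] [CommRing B]

/-- The map `Δ_A : 𝕎(A) → 𝕎(𝕎(A))`, on underlying sets. -/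
def deltaFun (a : BigWitt A) : BigWitt (BigWitt A) :=
  ⟨fun e => map (spec fun _ => a) (exists_delta e).choose⟩

theorem map_deltaFun (f : A →+* B) (a : BigWitt A) :
    map (map f) (deltaFun a) = deltaFun (map f a) := by
  refine BigWitt.ext (funext fun e => ?_)
  change mapFun f (mapFun _ _) = mapFun (spec fun _ => mapFun f a) _
  rw [← comp_spec]; rfl

theorem ghost_deltaFun (n : ℕ+) (a : BigWitt A) : ghost n (deltaFun a) = frob n a := by
  have h : ghost n (deltaFun gen) = frob n gen := by
    refine ghost_injective fun m => ?_
    rw [ghost_frob, mul_comm, ← psi_ghost]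
    change ghost m (ghostFun _ n) = psi m (ghostFun _ n)
    have hid : (spec fun _ => gen) = RingHom.id Rep :=
      MvPolynomial.ringHom_ext (fun z => by simp) fun i => by simp [spec, univ]
    rw [ghostFun, ghostFun, map_sum, map_sum]
    refine Finset.sum_congr rfl fun d _ => ?_
    rw [map_mul, map_mul, map_natCast, map_natCast, map_pow, map_pow]
    congr 2
    change ghost m (mapFun (spec fun _ => gen) (exists_delta d).choose) = _
    rw [hid]
    exact (exists_delta d).choose_spec m
  have ha : map (spec fun _ => a) gen = a := mapFun_spec_univ _ _
  rw [← ha, ← map_deltaFun, ghost_map, h, map_frob]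

variable (A) in
/-- The natural ring homomorphism `Δ_A : 𝕎(A) → 𝕎(𝕎(A))` with `w_n(Δ_A(a)) = F_n(a)`. -/
def comul : BigWitt A →+* BigWitt (BigWitt A) where
  toFun := deltaFun
  map_one' := by
    rw [← map_one (map (cover A)), ← map_deltaFun, ← map_one (map (map (cover A)))]
    exact congrArg _ (ghost_injective fun n => by simp only [ghost_deltaFun, map_one])
  map_mul' a b := by
    obtain ⟨a, rfl⟩ : ∃ x, map (cover A) x = a := cover_surjective A a
    obtain ⟨b, rfl⟩ : ∃ x, map (cover A) x = b := cover_surjective A b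
    rw [← map_mul, ← map_deltaFun, ← map_deltaFun, ← map_deltaFun, ← map_mul]
    exact congrArg _ (ghost_injective fun n => by simp only [ghost_deltaFun, map_mul])
  map_zero' := by
    rw [← map_zero (map (cover A)), ← map_deltaFun, ← map_zero (map (map (cover A)))]
    exact congrArg _ (ghost_injective fun n => by simp only [ghost_deltaFun, map_zero])
  map_add' a b := by
    obtain ⟨a, rfl⟩ : ∃ x, map (cover A) x = a := cover_surjective A a
    obtain ⟨b, rfl⟩ : ∃ x, map (cover A) x = b := cover_surjective A b
    rw [← map_add, ← map_deltaFun, ← map_deltaFun, ← map_deltaFun, ← map_add]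
    exact congrArg _ (ghost_injective fun n => by simp only [ghost_deltaFun, map_add])

theorem ghost_comul (n : ℕ+) (a : BigWitt A) : ghost n (comul A a) = frob n a :=
  ghost_deltaFun n a

theorem map_comul (f : A →+* B) (a : BigWitt A) :
    map (map f) (comul A a) = comul B (map f a) := map_deltaFun f a

end Delta

end BigWitt

/-! ### λ-rings -/

/-- A λ-ring structure on the commutative ring `A`: a ring homomorphism `λ_A : A → 𝕎(A)` that
makes `A` a coalgebra over the comonad `(𝕎, Δ, ε)`. -/
class LambdaRing (A : Type*) [CommRing A] where
  /-- The structure map `λ_A`. -/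
  lam : A →+* BigWitt A
  /-- `ε_A ∘ λ_A = id`. -/
  counit_lam : (BigWitt.counit A).comp lam = RingHom.id A
  /-- `𝕎(λ_A) ∘ λ_A = Δ_A ∘ λ_A`. -/
  map_lam : (BigWitt.map lam).comp lam = (BigWitt.comul A).comp lam

namespace LambdaRing

variable (A : Type*) [CommRing A] [LambdaRing A]

/-- The `n`th associated Adams operation `ψ_{A,n} = w_n ∘ λ_A`. -/
def adams (n : ℕ+) : A →+* A := (BigWitt.ghost n).comp lam

theorem adams_one : adams A 1 = RingHom.id A := counit_lam

theorem adams_mul (m n : ℕ+) : adams A (m * n) = (adams A m).comp (adams A n) := by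
  ext a
  have h := congrArg (fun f => BigWitt.ghost n (f a)) (map_lam (A := A))
  simp only [RingHom.comp_apply, BigWitt.ghost_map, BigWitt.ghost_comul] at h
  simp only [adams, RingHom.comp_apply, h, BigWitt.ghost_frob, mul_comm]

/-- The action of the monoid of positive integers on `A` through the Adams operations. -/
@[reducible]
def adamsAction : MulSemiringAction ℕ+ A where
  smul n a := adams A n a
  one_smul a := by change adams A 1 a = a; rw [adams_one]; rfl
  mul_smul m n a := by change adams A (m * n) a = adams A m (adams A n a); rw [adams_mul]; rfl
  smul_zero n := map_zero (adams A n)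
  smul_add n := map_add (adams A n)
  smul_one n := map_one (adams A n)
  smul_mul n := map_mul (adams A n)

end LambdaRing

/-- The twisted monoid algebra `A^ψ[ℕ]`: the free `A`-module on the multiplicative monoid of
positive integers, with the product determined by `n · a = ψ_{A,n}(a) · n`. -/
def TwistedMonoidAlgebra (A : Type*) [CommRing A] [LambdaRing A] : Type _ :=
  SkewMonoidAlgebra A ℕ+

namespace TwistedMonoidAlgebra

variable (A : Type*) [CommRing A] [LambdaRing A]

instance : Ring (TwistedMonoidAlgebra A) :=
  letI := LambdaRing.adamsAction A
  inferInstanceAs (Ring (SkewMonoidAlgebra A ℕ+))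

/-- The inclusion `A → A^ψ[ℕ]`. -/
def ofBase : A →+* TwistedMonoidAlgebra A :=
  letI := LambdaRing.adamsAction A
  (SkewMonoidAlgebra.singleOneRingHom : A →+* SkewMonoidAlgebra A ℕ+)

/-- The inclusion `ℕ → A^ψ[ℕ]` of the monoid of positive integers. -/
def ofNat : ℕ+ →* TwistedMonoidAlgebra A :=
  letI := LambdaRing.adamsAction A
  (SkewMonoidAlgebra.of A ℕ+ : ℕ+ →* SkewMonoidAlgebra A ℕ+)

theorem ofNat_mul_ofBase (n : ℕ+) (a : A) :
    ofNat A n * ofBase A a = ofBase A (LambdaRing.adams A n a) * ofNat A n := by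
  let _ := LambdaRing.adamsAction A
  refine (SkewMonoidAlgebra.single_mul_single (k := A) (a₁ := n) (a₂ := 1) (b₁ := 1)
    (b₂ := a)).trans (Eq.trans ?_ (SkewMonoidAlgebra.single_mul_single (k := A) (a₁ := 1)
    (a₂ := n) (b₁ := LambdaRing.adams A n a) (b₂ := 1)).symm)
  rw [one_smul, mul_one, one_mul, mul_one, one_mul]
  rfl

end TwistedMonoidAlgebra

/-! ### Modules over λ-rings -/

/-- The set `𝕎(M)` of Witt vectors in a module `M`, regarded as a non-unital ring with zero
multiplication. Its addition is componentwise. -/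
def WittModule (M : Type*) : Type _ := ℕ+ → M

namespace WittModule

/-- `𝕎(h) : 𝕎(M) → 𝕎(N)`, applying `h` to every Witt component. -/
def map {M N : Type*} (h : M → N) (x : WittModule M) : WittModule N := fun n => h (x n)

/-- `ε_M : 𝕎(M) → M`, the first component. -/
def counit {M : Type*} (x : WittModule M) : M := x 1

/-- `Δ_M : 𝕎(M) → 𝕎(𝕎(M))`: the `m`th component of the `e`th component of `Δ_M(x)` is
`x_{em}`. -/
def comul {M : Type*} (x : WittModule M) : WittModule (WittModule M) := fun e m => x (e * m)

instance {M : Type*} [AddCommGroup M] : AddCommGroup (WittModule M) :=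
  inferInstanceAs (AddCommGroup (ℕ+ → M))

/-- The `𝕎(A)`-module structure on `𝕎(M)`, given by `(a x)_n = w_n(a) x_n`. -/
instance {A M : Type*} [CommRing A] [AddCommGroup M] [Module A M] :
    Module (BigWitt A) (WittModule M) where
  smul a x := fun n => BigWitt.ghost n a • x n
  one_smul x := funext fun n => by
    change BigWitt.ghost n (1 : BigWitt A) • x n = x n
    rw [map_one, one_smul]
  mul_smul a b x := funext fun n => by
    change BigWitt.ghost n (a * b) • x n = BigWitt.ghost n a • BigWitt.ghost n b • x n
    rw [map_mul, mul_smul]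
  smul_zero a := funext fun n => smul_zero (BigWitt.ghost n a)
  smul_add a x y := funext fun n => smul_add (BigWitt.ghost n a) (x n) (y n)
  add_smul a b x := funext fun n => by
    change BigWitt.ghost n (a + b) • x n = BigWitt.ghost n a • x n + BigWitt.ghost n b • x n
    rw [map_add, add_smul]
  zero_smul x := funext fun n => by
    change BigWitt.ghost n (0 : BigWitt A) • x n = 0
    rw [map_zero, zero_smul]

/-! The following facts show that the structure defined above on `𝕎(M)` is the one inherited from
the big Witt vectors of the square-zero extension `A ⊕ M`. -/

section SquareZero

open TrivSqZeroExt

/-- The map `in_{2*} : 𝕎(M) → 𝕎(A ⊕ M)`. -/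
def incl (A : Type*) {M : Type*} [CommRing A] (x : WittModule M) :
    BigWitt (TrivSqZeroExt A M) := ⟨fun n => inr (x n)⟩

variable {A M : Type*} [CommRing A] [AddCommGroup M] [Module A M]

/-- The module component of the surjection onto `A ⊕ M`. -/
def covSnd : (M →₀ MvPolynomial A ℤ) →+ M :=
  Finsupp.liftAddHom fun m => (LinearMap.toSpanSingleton A M m).toAddMonoidHom.comp
    (BigWitt.cover A).toAddMonoidHom

theorem covSnd_smul (p : MvPolynomial A ℤ) (q : M →₀ MvPolynomial A ℤ) :
    covSnd (p • q) = BigWitt.cover A p • covSnd q := by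
  induction q using Finsupp.induction_linear with
  | zero => simp
  | add f g hf hg => rw [smul_add, map_add, map_add, smul_add, hf, hg]
  | single m r => rw [Finsupp.smul_single, smul_eq_mul]; simp only [covSnd, Finsupp.liftAddHom_apply_single, AddMonoidHom.comp_apply]; simp [mul_smul]

theorem exists_incl (x : WittModule M) : ∃ y : WittModule (M →₀ MvPolynomial A ℤ),
    map covSnd y = x :=
  ⟨fun n => Finsupp.single (x n) 1, funext fun n => by simp [map, covSnd]⟩

variable [Module Aᵐᵒᵖ M] [IsCentralScalar A M]

theorem ghost_incl (x : WittModule M) (n : ℕ+) :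
    BigWitt.ghost n (incl A x) = (n : ℕ) • inr (x n) := by
  change BigWitt.ghostFun _ n = _
  rw [BigWitt.ghostFun_eq, Finset.sum_eq_zero, add_zero, nsmul_eq_mul]
  · rfl
  · intro d hd
    obtain ⟨c, hc⟩ := PNat.dvd_iff.1 (BigWitt.mem_divs.1 (Finset.mem_of_mem_erase hd))
    have hlt := PNat.coe_lt_coe _ _ |>.2 (BigWitt.lt_of_mem_erase hd)
    rw [hc, Nat.mul_div_cancel_left _ d.pos]
    obtain ⟨k, rfl⟩ : ∃ k, c = k + 2 := by
      refine ⟨c - 2, ?_⟩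
      rcases c with _ | _ | c
      · rw [hc] at hlt; simp at hlt
      · rw [hc] at hlt; simp at hlt
      · omega
    change _ * (inr (x d)) ^ (k + 2) = (0 : TrivSqZeroExt A M)
    rw [pow_add, pow_two, inr_mul_inr, mul_zero, mul_zero]

/-- A torsion free square-zero extension that surjects onto `A ⊕ M`. -/
abbrev Cov (A M : Type*) [CommRing A] : Type _ :=
  TrivSqZeroExt (MvPolynomial A ℤ) (M →₀ MvPolynomial A ℤ)

/-- The surjection onto `A ⊕ M`. -/
def covMap : Cov A M →+* TrivSqZeroExt A M where
  toFun t := inl (BigWitt.cover A t.fst) + inr (covSnd t.snd)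
  map_one' := by ext <;> simp
  map_mul' s t := by ext <;> simp [covSnd_smul]
  map_zero' := by ext <;> simp
  map_add' s t := by ext <;> simp

instance : IsAddTorsionFree (Cov A M) :=
  inferInstanceAs (IsAddTorsionFree (MvPolynomial A ℤ × (M →₀ MvPolynomial A ℤ)))

theorem map_incl (y : WittModule (M →₀ MvPolynomial A ℤ)) :
    BigWitt.map covMap (incl _ y) = incl A (map (covSnd (A := A)) y) :=
  BigWitt.ext (funext fun n => by
    change covMap (inr (y n)) = inr (covSnd (y n))
    simp [covMap])

theorem incl_add (x y : WittModule M) : incl A (x + y) = incl A x + incl A y := by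
  obtain ⟨x, rfl⟩ := exists_incl (A := A) x
  obtain ⟨y, rfl⟩ := exists_incl (A := A) y
  have h : map (covSnd (A := A)) x + map covSnd y = map covSnd (x + y) :=
    funext fun n => (map_add covSnd (x n) (y n)).symm
  rw [h, ← map_incl, ← map_incl, ← map_incl, ← map_add]
  refine congrArg _ (BigWitt.ghost_injective fun n => ?_)
  rw [map_add, ghost_incl, ghost_incl, ghost_incl, ← nsmul_add, ← inr_add]; rfl

theorem map_inl_mul_incl (a : BigWitt A) (x : WittModule M) :
    BigWitt.map (inlHom A M) a * incl A x = incl A (a • x) := by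
  obtain ⟨x, rfl⟩ := exists_incl (A := A) x
  obtain ⟨a, rfl⟩ : ∃ y, BigWitt.map (BigWitt.cover A) y = a := BigWitt.cover_surjective A a
  have h : BigWitt.map (BigWitt.cover A) a • map covSnd x = map covSnd (a • x) :=
    funext fun n => by
      change BigWitt.ghost n (BigWitt.map (BigWitt.cover A) a) • covSnd (x n) = covSnd (BigWitt.ghost n a • x n)
      rw [covSnd_smul, BigWitt.ghost_map]
  have h' : BigWitt.map (inlHom A M) (BigWitt.map (BigWitt.cover A) a) =
      BigWitt.map covMap (BigWitt.map (inlHom _ (M →₀ MvPolynomial A ℤ)) a) :=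
    BigWitt.ext (funext fun n => by
      change (inl (BigWitt.cover A (a.coeff n)) : TrivSqZeroExt A M) = covMap (inl (a.coeff n))
      simp [covMap])
  rw [h, h', ← map_incl, ← map_incl, ← map_mul]
  refine congrArg _ (BigWitt.ghost_injective fun n => ?_)
  rw [map_mul, ghost_incl, ghost_incl, BigWitt.ghost_map, mul_smul_comm, inlHom_apply,
    inl_mul_inr]; rfl

theorem counit_incl (x : WittModule M) :
    BigWitt.counit _ (incl A x) = inr (counit x) := by
  rw [BigWitt.counit, ghost_incl, PNat.one_coe, one_smul]; rfl

theorem comul_incl (x : WittModule M) :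
    BigWitt.comul _ (incl A x) = ⟨fun e => incl A (comul x e)⟩ := by
  obtain ⟨x, rfl⟩ := exists_incl (A := A) x
  have h : (⟨fun e => incl A (comul (map (covSnd (A := A)) x) e)⟩ : BigWitt (BigWitt _)) =
      BigWitt.map (BigWitt.map covMap) ⟨fun e => incl _ (comul x e)⟩ :=
    BigWitt.ext (funext fun e => (map_incl (comul x e)).symm)
  rw [h, ← map_incl, ← BigWitt.map_comul]
  refine congrArg _ (BigWitt.ghost_injective fun n => BigWitt.ghost_injective fun m => ?_)
  rw [BigWitt.ghost_comul, BigWitt.ghost_frob, ghost_incl]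
  change _ = BigWitt.ghost m (BigWitt.ghostFun _ n)
  rw [BigWitt.ghostFun_eq, map_add, map_mul, map_natCast, map_sum, Finset.sum_eq_zero, add_zero,
    ghost_incl, PNat.mul_coe, mul_smul, nsmul_eq_mul]
  · rfl
  · intro d hd
    obtain ⟨c, hc⟩ := PNat.dvd_iff.1 (BigWitt.mem_divs.1 (Finset.mem_of_mem_erase hd))
    have hlt := PNat.coe_lt_coe _ _ |>.2 (BigWitt.lt_of_mem_erase hd)
    rw [hc, Nat.mul_div_cancel_left _ d.pos]
    obtain ⟨k, rfl⟩ : ∃ k, c = k + 2 := by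
      refine ⟨c - 2, ?_⟩
      rcases c with _ | _ | c
      · rw [hc] at hlt; simp at hlt
      · rw [hc] at hlt; simp at hlt
      · omega
    rw [map_mul, map_pow, ghost_incl, pow_add, pow_two, smul_mul_smul_comm, inr_mul_inr,
      smul_zero, mul_zero, mul_zero]

end SquareZero

end WittModule

/-- An `(A, λ_A)`-module: an `A`-module `M` with a `λ_A`-linear map `λ_M : M → 𝕎(M)` that
satisfies `ε_M ∘ λ_M = id` and `𝕎(λ_M) ∘ λ_M = Δ_M ∘ λ_M`. -/
structure LambdaModule (A : Type u) [CommRing A] [LambdaRing A] where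
  /-- The underlying `A`-module. -/
  toModuleCat : ModuleCat.{v} A
  /-- The structure map `λ_M`. -/
  lam : toModuleCat →ₛₗ[LambdaRing.lam (A := A)] WittModule toModuleCat
  /-- `ε_M ∘ λ_M = id`. -/
  counit_lam : ∀ x, WittModule.counit (lam x) = x
  /-- `𝕎(λ_M) ∘ λ_M = Δ_M ∘ λ_M`. -/
  map_lam : ∀ x, WittModule.map lam (lam x) = WittModule.comul (lam x)

namespace LambdaModule

variable {A : Type u} [CommRing A] [LambdaRing A]

/-- A morphism of `(A, λ_A)`-modules: an `A`-linear map `h` with `λ_N ∘ h = 𝕎(h) ∘ λ_M`. -/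
@[ext]
structure Hom (M N : LambdaModule.{u, v} A) where
  /-- The underlying `A`-linear map. -/
  hom : M.toModuleCat ⟶ N.toModuleCat
  /-- `λ_N ∘ h = 𝕎(h) ∘ λ_M`. -/
  lam_hom : ∀ x, N.lam (hom x) = WittModule.map hom (M.lam x)

instance : Category (LambdaModule.{u, v} A) where
  Hom := Hom
  id M := ⟨𝟙 _, fun _ => rfl⟩
  comp f g := ⟨f.hom ≫ g.hom, fun x => by
    change _ = WittModule.map g.hom (WittModule.map f.hom _)
    rw [← f.lam_hom, ← g.lam_hom]; rfl⟩

variable (A) in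
/-- The forgetful functor from `(A, λ_A)`-modules to `A`-modules. -/
def forget : LambdaModule.{u, v} A ⥤ ModuleCat.{v} A where
  obj M := M.toModuleCat
  map f := f.hom

end LambdaModule

end

noncomputable section

/-! ### Components of the structure map -/

namespace LambdaModule

variable {A : Type u} [CommRing A] [LambdaRing A]

/-! `𝕎(A)` acts on `𝕎(M)` through its ghost components, so a module over a λ-ring involves no Witt
vector polynomials. Read one component at a time, `λ_M` is a family of additive maps `λ_{M,n} : M →
M`. Linearity over `λ_A` makes `λ_{M,n}` semilinear along `ψ_{A,n} = w_n ∘ λ_A`. The counit axiom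
says `λ_{M,1} = id`, and the coassociativity axiom says `λ_{M,m} λ_{M,n} = λ_{M,nm}`. The structure
is therefore an action of the multiplicative monoid of positive integers on `M`, semilinear along
the Adams operations.

Such an action is the same as a module over `A^ψ[ℕ]`: the relation `n · a = ψ_{A,n}(a) · n` is
exactly semilinearity. This gives the equivalence (`lift`, `induction_on`, `ofTwistedToTwistedIso`),
and abelianness is transported along it from a module category.

Creation of limits and colimits asks for equality of cones, which an equivalence does not see, so it
is proved directly. The map `λ_{M,n}` is an `A`-linear map from `M` to its restriction of scalars
along `ψ_{A,n}`, natural in `M` (`componentNatTrans`). It therefore induces a map on any limit or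
colimit of underlying modules. The projections of a limit are jointly injective, and the legs of a
colimit are jointly epimorphic even for semilinear maps (`limit_ext`, `colimit_map_ext`). These two
facts give the axioms, the uniqueness of the structure, and the compatibility of universal maps with
it. -/

theorem lam_one (M : LambdaModule.{u, v} A) (x : M.toModuleCat) : M.lam x 1 = x :=
  M.counit_lam x

/-- Coassociativity read at component `n` and then `m`. The product comes out as `n * m`, the order
fixed by `Δ_M`; it is harmless since the monoid is commutative. -/
theorem lam_lam (M : LambdaModule.{u, v} A) (m n : ℕ+) (x : M.toModuleCat) :
    M.lam (M.lam x n) m = M.lam x (n * m) :=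
  congrFun (congrFun (M.map_lam x) n) m

theorem lam_add (M : LambdaModule.{u, v} A) (n : ℕ+) (x y : M.toModuleCat) :
    M.lam (x + y) n = M.lam x n + M.lam y n :=
  congrFun (map_add M.lam x y) n

/-- The action of `𝕎(A)` on the `n`th component is through `w_n`, and `w_n ∘ λ_A` is the `n`th Adams
operation. -/
theorem lam_smul (M : LambdaModule.{u, v} A) (n : ℕ+) (a : A) (x : M.toModuleCat) :
    M.lam (a • x) n = LambdaRing.adams A n a • M.lam x n :=
  congrFun (M.lam.map_smulₛₗ a x) n

/-- The `n`th component `λ_{M,n}` of the structure map, a `ψ_{A,n}`-semilinear map. -/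
def component (M : LambdaModule.{u, v} A) (n : ℕ+) :
    M.toModuleCat →ₛₗ[LambdaRing.adams A n] M.toModuleCat where
  toFun x := M.lam x n
  map_add' := M.lam_add n
  map_smul' := M.lam_smul n

theorem hom_lam {M N : LambdaModule.{u, v} A} (f : M ⟶ N) (n : ℕ+) (x : M.toModuleCat) :
    N.lam (f.hom x) n = f.hom (M.lam x n) :=
  congrFun (f.lam_hom x) n

/-- The `(A, λ_A)`-module structure given by an action of the monoid of positive integers through
semilinear maps. -/
def ofComponents (M : ModuleCat.{v} A) (φ : ∀ n : ℕ+, M →ₛₗ[LambdaRing.adams A n] M)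
    (h1 : ∀ x, φ 1 x = x) (hmul : ∀ m n x, φ m (φ n x) = φ (n * m) x) :
    LambdaModule.{u, v} A where
  toModuleCat := M
  lam :=
    { toFun := fun x n => φ n x
      map_add' := fun x y => funext fun n => map_add (φ n) x y
      map_smul' := fun a x => funext fun n => (φ n).map_smulₛₗ a x }
  counit_lam := h1
  map_lam x := funext fun n => funext fun m => hmul m n x

theorem ext_lam {M : ModuleCat.{v} A} {l l' : M →ₛₗ[LambdaRing.lam (A := A)] WittModule M}
    (h : ∀ x n, l x n = l' x n) : l = l' :=
  LinearMap.ext fun x => funext fun n => h x n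

instance : (forget.{u, v} A).Faithful where
  map_injective h := Hom.ext h

/-! ### Limits and colimits -/

/-- The components `λ_{M,n}` form a natural transformation. -/
def componentNatTrans (n : ℕ+) :
    forget.{u, v} A ⟶ forget A ⋙ ModuleCat.restrictScalars (LambdaRing.adams A n) where
  app M := ModuleCat.semilinearMapAddEquiv _ _ _ (M.component n)
  naturality M N f := by
    ext x
    exact hom_lam f n x

/-! ### Creation of limits -/

section Limits

variable {J : Type v} [SmallCategory J] {K : J ⥤ LambdaModule.{u, v} A}
  {c : Cone (K ⋙ forget A)} (hc : IsLimit c)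

include hc in
theorem limit_ext {x y : c.pt} (h : ∀ j, c.π.app j x = c.π.app j y) : x = y :=
  Concrete.isLimit_ext _ hc x y h

/-- The `n`th component of the structure map on a limit. -/
def limitComponent (n : ℕ+) : c.pt →ₛₗ[LambdaRing.adams A n] c.pt :=
  (ModuleCat.semilinearMapAddEquiv _ _ _).symm
    -- Restriction of scalars preserves limits, so the restricted cone is again a limit. The maps
    -- `λ_n` on the diagram, composed with the projections, form a cone over the restricted diagram.
    ((isLimitOfPreserves (ModuleCat.restrictScalars (LambdaRing.adams A n)) hc).lift
      ⟨c.pt, c.π ≫ Functor.whiskerLeft K (componentNatTrans n)⟩)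

theorem π_limitComponent (n : ℕ+) (j : J) (x : c.pt) :
    c.π.app j (limitComponent hc n x) = (K.obj j).lam (c.π.app j x) n :=
  ConcreteCategory.congr_hom
    ((isLimitOfPreserves (ModuleCat.restrictScalars (LambdaRing.adams A n)) hc).fac
      ⟨c.pt, c.π ≫ Functor.whiskerLeft K (componentNatTrans n)⟩ j) x

/-- The lift of a limit cone of `A`-modules to a cone of `(A, λ_A)`-modules. -/
def liftCone : Cone K where
  pt := ofComponents c.pt (limitComponent hc)
    (fun x => limit_ext hc fun j =>
      (π_limitComponent hc 1 j x).trans (lam_one (K.obj j) _))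
    (fun m n x => limit_ext hc fun j => by
      rw [π_limitComponent, π_limitComponent, π_limitComponent]
      exact lam_lam (K.obj j) m n _)
  π :=
    { app := fun j => ⟨c.π.app j, fun x => funext fun n => (π_limitComponent hc n j x).symm⟩
      naturality := fun _ _ f => Hom.ext (c.π.naturality f) }

/-- The underlying module and the legs are visible after forgetting, so only `λ` could differ. The
legs commute with both structures and are jointly injective, which forces the two to agree. -/
theorem eq_of_mapCone_eq {c₁ c₂ : Cone K} (h : (forget A).mapCone c₁ = (forget A).mapCone c₂)
    (h₁ : IsLimit ((forget A).mapCone c₁)) : c₁ = c₂ := by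
  obtain ⟨⟨M, l, hl, hl'⟩, π⟩ := c₁
  obtain ⟨⟨M', l', hm, hm'⟩, π'⟩ := c₂
  obtain rfl : M = M' := congrArg Cone.pt h
  have hπ : ∀ j, (π.app j).hom = (π'.app j).hom := fun j =>
    -- The legs are only heterogeneously equal until the two underlying modules have been
    -- identified.
    NatTrans.congr_app (eq_of_heq (Cone.mk.inj h).2) j
  obtain rfl : l = l' := ext_lam fun x n => limit_ext h₁ fun j => by
    refine (hom_lam (π.app j) n x).symm.trans ?_
    refine Eq.trans ?_ ((hom_lam (π'.app j) n x).trans ?_)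
    · rw [hπ]
    · exact ConcreteCategory.congr_hom (hπ j).symm _
  obtain rfl : π = π' := by
    ext j : 2
    exact Hom.ext (hπ j)
  rfl

/-- The forgetful functor reflects limits. -/
def isLimitOfForget {c' : Cone K} (h : IsLimit ((forget A).mapCone c')) : IsLimit c' :=
  .ofFaithful (forget A) h
    -- The `A`-linear lift respects `λ` because, after projection to each `j`, both sides become `λ`
    -- of `K.obj j` applied to the leg of `s`.
    (fun s => ⟨h.lift ((forget A).mapCone s), fun x => funext fun n => limit_ext h fun j => by
      have key : ∀ y, ((forget A).mapCone c').π.app j (h.lift ((forget A).mapCone s) y) =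
          (s.π.app j).hom y :=
        ConcreteCategory.congr_hom (h.fac ((forget A).mapCone s) j)
      refine (hom_lam (c'.π.app j) n _).symm.trans ?_
      refine Eq.trans ?_ (key _).symm
      refine Eq.trans ?_ (hom_lam (s.π.app j) n x)
      exact congrArg (fun y => (K.obj j).lam y n) (key x)⟩)
    (fun s => rfl)

end Limits

instance createsLimits : CreatesLimits (forget.{u, v} A) where
  CreatesLimitsOfShape :=
    { CreatesLimit :=
        { reflects := fun h => ⟨isLimitOfForget h⟩
          -- The lifted cone maps to the given one on the nose, so the comparison isomorphism is the
          -- identity.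
          lifts := fun _ hc => ⟨liftCone hc, Iso.refl _⟩ } }

/-! ### Creation of colimits -/

section Colimits

variable {J : Type v} [SmallCategory J] {K : J ⥤ LambdaModule.{u, v} A}
  {c : Cocone (K ⋙ forget A)} (hc : IsColimit c)

include hc in
-- A `σ`-semilinear map into `N` is an `A`-linear map into the restriction of scalars of `N` along
-- `σ`, so uniqueness in the universal property of the colimit applies. It replaces the elementwise
-- argument used for limits.
theorem colimit_map_ext {σ : A →+* A} {N : ModuleCat.{v} A} {f g : c.pt →ₛₗ[σ] N}
    (h : ∀ j x, f (c.ι.app j x) = g (c.ι.app j x)) : f = g :=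
  (ModuleCat.semilinearMapAddEquiv _ _ _).injective <| hc.hom_ext fun j => by
    ext x
    exact h j x

/-- The cocone whose universal map is the `n`th component of the structure map on a colimit. -/
def componentCocone (c : Cocone (K ⋙ forget A)) (n : ℕ+) : Cocone (K ⋙ forget A) :=
  (Cocone.precompose (Functor.whiskerLeft K (componentNatTrans n))).obj
    ((ModuleCat.restrictScalars (LambdaRing.adams A n)).mapCocone c)

/-- The `n`th component of the structure map on a colimit. -/
def colimitComponent (n : ℕ+) : c.pt →ₛₗ[LambdaRing.adams A n] c.pt :=
  -- The restricted module is only a target here, so the universal property of `c` suffices and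
  -- nothing about preservation of colimits is needed.
  (ModuleCat.semilinearMapAddEquiv _ _ _).symm (hc.desc (componentCocone c n))

theorem colimitComponent_ι (n : ℕ+) (j : J) (x : (K.obj j).toModuleCat) :
    colimitComponent hc n (c.ι.app j x) = c.ι.app j ((K.obj j).lam x n) :=
  ConcreteCategory.congr_hom (hc.fac (componentCocone c n) j) x

theorem colimitComponent_one (x : c.pt) : colimitComponent hc 1 x = x := by
  -- The identity has to be presented as semilinear along `adams A 1`, which equals the identity
  -- ring map but not by definition.
  let f : c.pt →ₛₗ[LambdaRing.adams A 1] c.pt :=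
    { toFun := fun x => x
      map_add' := fun _ _ => rfl
      map_smul' := fun a x => by rw [LambdaRing.adams_one, RingHom.id_apply] }
  have h : colimitComponent hc 1 = f := colimit_map_ext hc fun j x =>
    (colimitComponent_ι hc 1 j x).trans (congrArg (c.ι.app j) (lam_one (K.obj j) x))
  exact LinearMap.congr_fun h x

theorem colimitComponent_mul (m n : ℕ+) (x : c.pt) :
    colimitComponent hc m (colimitComponent hc n x) = colimitComponent hc (n * m) x := by
  -- Multiplicativity of the Adams operations makes the composite semilinear along `adams A (n *
  -- m)`, so it can be compared with that component on the legs.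
  have : RingHomCompTriple (LambdaRing.adams A n) (LambdaRing.adams A m)
      (LambdaRing.adams A (n * m)) := ⟨by rw [mul_comm, LambdaRing.adams_mul]⟩
  have h : (colimitComponent hc m).comp (colimitComponent hc n) = colimitComponent hc (n * m) :=
    colimit_map_ext hc fun j x => by
      refine Eq.trans ?_ (colimitComponent_ι hc (n * m) j x).symm
      refine (congrArg (colimitComponent hc m) (colimitComponent_ι hc n j x)).trans ?_
      exact (colimitComponent_ι hc m j _).trans (congrArg (c.ι.app j) (lam_lam (K.obj j) m n x))
  exact LinearMap.congr_fun h x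

/-- The lift of a colimit cocone of `A`-modules to a cocone of `(A, λ_A)`-modules. -/
def liftCocone : Cocone K where
  pt := ofComponents c.pt (colimitComponent hc) (colimitComponent_one hc)
    (colimitComponent_mul hc)
  ι :=
    { app := fun j => ⟨c.ι.app j, fun x => funext fun n => colimitComponent_ι hc n j x⟩
      naturality := fun _ _ f => Hom.ext (c.ι.naturality f) }

/-- As for limits, only `λ` is in question. Its values on the images of the legs are prescribed, and
these determine each semilinear component. -/
theorem eq_of_mapCocone_eq {c₁ c₂ : Cocone K}
    (h : (forget A).mapCocone c₁ = (forget A).mapCocone c₂)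
    (h₁ : IsColimit ((forget A).mapCocone c₁)) : c₁ = c₂ := by
  obtain ⟨M₁, ι₁⟩ := c₁
  obtain ⟨M₂, ι₂⟩ := c₂
  obtain ⟨M, l, hl, hl'⟩ := M₁
  obtain ⟨M', l', hm, hm'⟩ := M₂
  obtain rfl : M = M' := congrArg Cocone.pt h
  have hι : ∀ j, (ι₁.app j).hom = (ι₂.app j).hom := fun j =>
    NatTrans.congr_app (eq_of_heq (Cocone.mk.inj h).2) j
  obtain rfl : l = l' := ext_lam fun x n => by
    have key : component ⟨M, l, hl, hl'⟩ n = component ⟨M, l', hm, hm'⟩ n :=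
      colimit_map_ext h₁ fun j y => by
        refine (hom_lam (ι₁.app j) n y).trans ?_
        refine Eq.trans ?_ ((hom_lam (ι₂.app j) n y).symm.trans ?_)
        · exact ConcreteCategory.congr_hom (hι j) _
        · rw [← hι]; rfl
    exact LinearMap.congr_fun key x
  obtain rfl : ι₁ = ι₂ := by
    ext j : 2
    exact Hom.ext (hι j)
  rfl

/-- The forgetful functor reflects colimits. -/
def isColimitOfForget {c' : Cocone K} (h : IsColimit ((forget A).mapCocone c')) :
    IsColimit c' :=
  .ofFaithful (forget A) h
    (fun s => ⟨h.desc ((forget A).mapCocone s), fun x => funext fun n => by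
      have fac : ∀ j y, h.desc ((forget A).mapCocone s) ((c'.ι.app j).hom y) =
          (s.ι.app j).hom y := fun j =>
        ConcreteCategory.congr_hom (h.fac ((forget A).mapCocone s) j)
      -- Both composites are `ψ_{A,n}`-semilinear maps out of the colimit, so agreement on the legs
      -- suffices.
      have key : (s.pt.component n).comp (h.desc ((forget A).mapCocone s)).hom =
          (h.desc ((forget A).mapCocone s)).hom.comp (c'.pt.component n) :=
        colimit_map_ext h fun j y => by
          refine (congrArg (s.pt.component n) (fac j y)).trans ?_
          refine (hom_lam (s.ι.app j) n y).trans ((fac j _).symm.trans ?_)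
          exact congrArg (h.desc ((forget A).mapCocone s)) (hom_lam (c'.ι.app j) n y).symm
      exact LinearMap.congr_fun key x⟩)
    (fun s => rfl)

end Colimits

instance createsColimits : CreatesColimits (forget.{u, v} A) where
  CreatesColimitsOfShape :=
    { CreatesColimit :=
        { reflects := fun h => ⟨isColimitOfForget h⟩
          lifts := fun _ hc => ⟨liftCocone hc, Iso.refl _⟩ } }

/-! ### Modules over the twisted monoid algebra -/

/-- The `(A, λ_A)`-module underlying a module over the twisted monoid algebra. -/
def ofTwisted (N : ModuleCat.{v} (TwistedMonoidAlgebra A)) : LambdaModule.{u, v} A :=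
  ofComponents ((ModuleCat.restrictScalars (TwistedMonoidAlgebra.ofBase A)).obj N)
    (fun n =>
      { toFun := fun x => TwistedMonoidAlgebra.ofNat A n • (show N from x)
        map_add' := fun x y => smul_add (A := N) _ x y
        map_smul' := fun a x => by
          change TwistedMonoidAlgebra.ofNat A n • TwistedMonoidAlgebra.ofBase A a •
            (show N from x) = TwistedMonoidAlgebra.ofBase A (LambdaRing.adams A n a) •
              TwistedMonoidAlgebra.ofNat A n • (show N from x)
          -- Semilinearity is exactly the defining relation of the twisted algebra.
          rw [smul_smul, smul_smul, TwistedMonoidAlgebra.ofNat_mul_ofBase] })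
    (fun x => by
      change TwistedMonoidAlgebra.ofNat A 1 • (show N from x) = x
      rw [map_one, one_smul])
    (fun m n x => by
      change TwistedMonoidAlgebra.ofNat A m • TwistedMonoidAlgebra.ofNat A n •
        (show N from x) = TwistedMonoidAlgebra.ofNat A (n * m) • (show N from x)
      rw [smul_smul, ← map_mul, mul_comm])

variable (A) in
/-- The functor from modules over the twisted monoid algebra to `(A, λ_A)`-modules. -/
def fromTwisted : ModuleCat.{v} (TwistedMonoidAlgebra A) ⥤ LambdaModule.{u, v} A where
  obj := ofTwisted
  map f := ⟨(ModuleCat.restrictScalars (TwistedMonoidAlgebra.ofBase A)).map f,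
    fun x => funext fun n => (f.hom.map_smul (TwistedMonoidAlgebra.ofNat A n) x).symm⟩

end LambdaModule

/-! ### Generators and mapping property of the twisted monoid algebra -/

namespace TwistedMonoidAlgebra

variable {A : Type u} [CommRing A] [LambdaRing A]

/-- The algebra is free as a left `A`-module on `ℕ`, so every element is a finite sum of terms `a ·
n` with the scalar on the left. -/
theorem induction_on {p : TwistedMonoidAlgebra A → Prop} (t : TwistedMonoidAlgebra A)
    (h0 : p 0) (hmul : ∀ a n, p (ofBase A a * ofNat A n))
    (hadd : ∀ s t, p s → p t → p (s + t)) : p t := by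
  let _ := LambdaRing.adamsAction A
  refine SkewMonoidAlgebra.induction_on (p := p) t h0 (fun n a => ?_) fun s t => hadd s t
  have h : (SkewMonoidAlgebra.single n a : SkewMonoidAlgebra A ℕ+) = ofBase A a * ofNat A n := by
    -- With the scalar on the left, only the monoid element `1` acts on a coefficient, so no Adams
    -- operation appears.
    refine Eq.trans ?_ (SkewMonoidAlgebra.single_mul_single (k := A) (a₁ := 1)
      (a₂ := n) (b₁ := a) (b₂ := 1)).symm
    rw [one_smul, mul_one, one_mul]
  exact h ▸ hmul a n

/-- Linearity need only be tested on the generators in `A` and `ℕ`. This is what makes `fromTwisted`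
full. -/
theorem map_smul_of {N N' : Type*} [AddCommGroup N] [AddCommGroup N']
    [Module (TwistedMonoidAlgebra A) N] [Module (TwistedMonoidAlgebra A) N'] (g : N →+ N')
    (hA : ∀ a x, g (ofBase A a • x) = ofBase A a • g x)
    (hn : ∀ n x, g (ofNat A n • x) = ofNat A n • g x) (t : TwistedMonoidAlgebra A) (x : N) :
    g (t • x) = t • g x := by
  induction t using induction_on with
  | h0 => rw [zero_smul, zero_smul, map_zero]
  | hmul a n => rw [mul_smul, hA, hn, mul_smul]
  | hadd s t hs ht => rw [add_smul, map_add, hs, ht, add_smul]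

/-- A homomorphism out of the twisted monoid algebra is given by homomorphisms out of `A` and `ℕ`
that satisfy the commutation relation. -/
def lift {R : Type*} [Ring R] (f : A →+* R) (g : ℕ+ →* R)
    (h : ∀ n a, g n * f a = f (LambdaRing.adams A n a) * g n) : TwistedMonoidAlgebra A →+* R :=
  letI := LambdaRing.adamsAction A
  SkewMonoidAlgebra.liftNCRingHom f g fun {a n} => (h n a).symm

theorem lift_ofBase {R : Type*} [Ring R] (f : A →+* R) (g : ℕ+ →* R)
    (h : ∀ n a, g n * f a = f (LambdaRing.adams A n a) * g n) (a : A) :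
    lift f g h (ofBase A a) = f a := by
  let _ := LambdaRing.adamsAction A
  refine (SkewMonoidAlgebra.liftNC_single (f : A →+ R) g 1 a).trans ?_
  rw [map_one, mul_one]; rfl

theorem lift_ofNat {R : Type*} [Ring R] (f : A →+* R) (g : ℕ+ →* R)
    (h : ∀ n a, g n * f a = f (LambdaRing.adams A n a) * g n) (n : ℕ+) :
    lift f g h (ofNat A n) = g n := by
  let _ := LambdaRing.adamsAction A
  refine (SkewMonoidAlgebra.liftNC_single (f : A →+ R) g n 1).trans ?_
  rw [AddMonoidHom.coe_coe, map_one, one_mul]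

end TwistedMonoidAlgebra

/-! ### The equivalence with modules over the twisted monoid algebra -/

namespace LambdaModule

variable {A : Type u} [CommRing A] [LambdaRing A]

/-- The action of the twisted monoid algebra on an `(A, λ_A)`-module. -/
def twistedAction (M : LambdaModule.{u, v} A) :
    TwistedMonoidAlgebra A →+* AddMonoid.End M.toModuleCat :=
  TwistedMonoidAlgebra.lift (Module.toAddMonoidEnd A M.toModuleCat)
    { toFun := fun n => (M.component n).toAddMonoidHom
      map_one' := AddMonoidHom.ext fun x => M.lam_one x
      map_mul' := fun m n => AddMonoidHom.ext fun x => by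
        rw [mul_comm]; exact (M.lam_lam m n x).symm }
    -- The commutation relation required by `lift` is the semilinearity of `λ_{M,n}`.
    fun n a => AddMonoidHom.ext fun x => M.lam_smul n a x

theorem twistedAction_ofBase (M : LambdaModule.{u, v} A) (a : A) (x : M.toModuleCat) :
    M.twistedAction (TwistedMonoidAlgebra.ofBase A a) x = a • x :=
  DFunLike.congr_fun (TwistedMonoidAlgebra.lift_ofBase _ _ _ a) x

theorem twistedAction_ofNat (M : LambdaModule.{u, v} A) (n : ℕ+) (x : M.toModuleCat) :
    M.twistedAction (TwistedMonoidAlgebra.ofNat A n) x = M.lam x n :=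
  DFunLike.congr_fun (TwistedMonoidAlgebra.lift_ofNat _ _ _ n) x

/-- The module over the twisted monoid algebra underlying an `(A, λ_A)`-module. -/
def toTwisted (M : LambdaModule.{u, v} A) : ModuleCat.{v} (TwistedMonoidAlgebra A) :=
  letI := Module.compHom M.toModuleCat M.twistedAction
  ModuleCat.of (TwistedMonoidAlgebra A) M.toModuleCat

/-- An `(A, λ_A)`-module is determined by its action of the twisted monoid algebra. -/
def ofTwistedToTwistedIso (M : LambdaModule.{u, v} A) : ofTwisted M.toTwisted ≅ M where
  hom :=
    { hom := ModuleCat.ofHom (X := (ofTwisted M.toTwisted).toModuleCat) (Y := M.toModuleCat)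
        { toFun := fun x => x
          map_add' := fun _ _ => rfl
          -- The scalar action on `ofTwisted M.toTwisted` passes through the twisted algebra. It
          -- agrees with the original one by a lemma, not by definition, so the identity map is an
          -- isomorphism between two presentations.
          map_smul' := M.twistedAction_ofBase }
      lam_hom := fun x => funext fun n => (M.twistedAction_ofNat n x).symm }
  inv :=
    { hom := ModuleCat.ofHom (X := M.toModuleCat) (Y := (ofTwisted M.toTwisted).toModuleCat)
        { toFun := fun x => x
          map_add' := fun _ _ => rfl
          map_smul' := fun a x => (M.twistedAction_ofBase a x).symm }
      lam_hom := fun x => funext fun n => M.twistedAction_ofNat n x }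
  hom_inv_id := rfl
  inv_hom_id := rfl

instance : (fromTwisted.{u, v} A).Faithful where
  map_injective h := by
    ext x
    exact ConcreteCategory.congr_hom (congrArg Hom.hom h) x

/-- A morphism of `(A, λ_A)`-modules is additive and commutes with `A` and with every `n`, hence
with the algebra that they generate. -/
instance : (fromTwisted.{u, v} A).Full where
  map_surjective {N N'} f := by
    let g : N →+ N' :=
      { toFun := fun x => f.hom x
        map_zero' := f.hom.hom.map_zero
        map_add' := f.hom.hom.map_add }
    exact ⟨ModuleCat.ofHom
      { toFun := g
        map_add' := g.map_add
        map_smul' := TwistedMonoidAlgebra.map_smul_of g f.hom.hom.map_smul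
          fun n x => (hom_lam f n x).symm }, rfl⟩

instance : (fromTwisted.{u, v} A).EssSurj where
  mem_essImage M := ⟨M.toTwisted, ⟨M.ofTwistedToTwistedIso⟩⟩

instance : (fromTwisted.{u, v} A).IsEquivalence where

variable (A) in
/-- The category of `(A, λ_A)`-modules is equivalent to the category of modules over the twisted
monoid algebra. -/
def twistedEquivalence : LambdaModule.{u, v} A ≌ ModuleCat.{v} (TwistedMonoidAlgebra A) :=
  (fromTwisted A).asEquivalence.symm

variable (A) in
/-- The equivalence is compatible with the forgetful functors. -/
def twistedEquivalenceForget : (twistedEquivalence.{u, v} A).functor ⋙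
    ModuleCat.restrictScalars (TwistedMonoidAlgebra.ofBase A) ≅ forget A :=
  Functor.isoWhiskerRight (twistedEquivalence A).unitIso.symm (forget A)

/-- Being abelian transfers along an equivalence. The addition of morphisms is pulled back from
modules over the twisted algebra, and finite products exist because an equivalence carries them
over. -/
theorem nonempty_abelian : Nonempty (Abelian (LambdaModule.{u, v} A)) := by
  let e := twistedEquivalence.{u, v} A
  let _ : Preadditive (LambdaModule.{u, v} A) := .ofFullyFaithful e.fullyFaithfulFunctor
  have : HasFiniteProducts (LambdaModule.{u, v} A) :=
    ⟨fun _ => Adjunction.hasLimitsOfShape_of_equivalence e.functor⟩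
  exact ⟨abelianOfEquivalence e.functor⟩

end LambdaModule

end

/-! ### The proposition -/

theorem mainTheorem6 (A : Type u) [CommRing A] [LambdaRing A] :
    Nonempty (Abelian (LambdaModule.{u, v} A)) ∧
    Nonempty (CreatesLimits (LambdaModule.forget.{u, v} A)) ∧
    Nonempty (CreatesColimits (LambdaModule.forget.{u, v} A)) ∧
    (∀ (J : Type v) [SmallCategory J] (K : J ⥤ LambdaModule.{u, v} A)
      (c : Cone (K ⋙ LambdaModule.forget A)), IsLimit c →
        ∃! c' : Cone K, (LambdaModule.forget A).mapCone c' = c) ∧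
    (∀ (J : Type v) [SmallCategory J] (K : J ⥤ LambdaModule.{u, v} A)
      (c : Cocone (K ⋙ LambdaModule.forget A)), IsColimit c →
        ∃! c' : Cocone K, (LambdaModule.forget A).mapCocone c' = c) ∧
    (∃ (e : LambdaModule.{u, v} A ≌ ModuleCat.{v} (TwistedMonoidAlgebra A))
      (α : e.functor ⋙ ModuleCat.restrictScalars (TwistedMonoidAlgebra.ofBase A) ≅
        LambdaModule.forget A),
      ∀ (M : LambdaModule.{u, v} A) (n : ℕ+) (y : e.functor.obj M),
        α.hom.app M (TwistedMonoidAlgebra.ofNat A n • y) = M.lam (α.hom.app M y) n) := by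
  refine ⟨LambdaModule.nonempty_abelian, ⟨inferInstance⟩, ⟨inferInstance⟩, fun J _ K c hc => ?_,
    fun J _ K c hc => ?_, LambdaModule.twistedEquivalence A,
    LambdaModule.twistedEquivalenceForget A, fun M n y => ?_⟩
  · exact ⟨LambdaModule.liftCone hc, rfl, fun c' h =>
      LambdaModule.eq_of_mapCone_eq h (h ▸ hc)⟩
  · exact ⟨LambdaModule.liftCocone hc, rfl, fun c' h =>
      LambdaModule.eq_of_mapCocone_eq h (h ▸ hc)⟩
  -- In `fromTwisted`, the `n`th component is multiplication by `n` by construction. What remains is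
  -- that the inverse unit, a morphism of `(A, λ_A)`-modules, commutes with the components.
  · exact (LambdaModule.hom_lam ((LambdaModule.twistedEquivalence A).unitIso.inv.app M) n y).symm
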